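/- Let $d\in\mathbb N$ and call a linear map on the space of complex $d\times d$ matrices a superoperator; $\mathcal I$ denotes the identity superoperator and products of superoperators are compositions. Let $\mathcal L_0,\mathcal L_I$ be superoperators and let $\mathfrak P$ be a hyperprojector, i.e. a linear idempotent map from superoperators to superoperators, such that $$\mathfrak P(\mathcal I)=\mathcal I,\qquad \mathfrak P(e^{\mathcal L_0 t}\Psi)=e^{\mathcal L_0 t}\mathfrak P(\Psi),\qquad \mathfrak P(\Psi e^{\mathcal L_0 t})=\mathfrak P(\Psi)e^{\mathcal L_0 t}$$ for all $t\in\mathbb R$ and all superoperators $\Psi$. For $\lambda\in\mathbb C$ and $t_0 \in\mathbb R$ let $\Phi(t,t_0)=\Phi_\lambda(t,t_0)$, $t\in\mathbb R$, be the solution of $$\frac{d}{dt}\Phi(t,t_0)=(\mathcal L_0+\lambda\mathcal L_I)\Phi(t,t_0),\qquad \Phi(t_0,t_0)=\mathcal I .$$ Put $\Phi_I(t,t_0)=e^{-\mathcal L_0(t-t_0)}\Phi(t,t_0)$, and $$\mathfrak K(t)=\mathcal L_0+e^{\mathcal L_0(t-t_0)}\,\mathfrak K^I(t)\,e^{-\mathcal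 L_0(t-t_0)},\qquad \mathfrak K^I(t)=\Big(\frac{d}{dt}\mathfrak P(\Phi_I(t,t_0))\Big)\,\mathfrak P(\Phi_I(t,t_0))^{-1}$$ whenever the inverse exists. Then, for all fixed $t_0,t\in\mathbb R$: (1) For all sufficiently small $|\lambda|$, $\mathfrak P(\Phi(t,t_0))$ is invertible (so that $\mathfrak K(t)$ is defined) and $$\frac{d}{dt}\mathfrak P(\Phi(t,t_0))=\mathfrak K(t)\,\mathfrak P(\Phi(t,t_0)).$$ (2) As $\lambda\to0$, $\mathfrak K(t)$ has the asymptotic expansion $\mathfrak K(t)\sim\sum_{n=0}^\infty\lambda^n\mathfrak K_n(t)$, i.e. $\mathfrak K(t)-\sum_{n=0}^N\lambda^n\mathfrak K_n(t)=O(\lambda^{N+1})$ for every $N\ge 0$, where $\mathfrak K_0(t)=\mathcal L_0$ and, for $n\ge1$, $$\mathfrak K_n(t)=\sum_{q=0}^{n-1}(-1)^q\sum_{\substack{k_0+\dots+k_q=n\\ k_j\ge1}}\grave{\mathfrak M}_{k_0}(t)\,\mathfrak M_{k_1}(t)\cdots\mathfrak M_{k_q}(t),$$ with, for $k\ge1$,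 $$\mathfrak M_k(t)=\int_{t_0}^t dt_k\int_{t_0}^{t_k}dt_{k-1}\cdots\int_{t_0}^{t_2}dt_1\,\mathfrak P\big(e^{\mathcal L_0(t-t_k)}\mathcal L_I e^{\mathcal L_0(t_k-t_{k-1})}\cdots e^{\mathcal L_0(t_2-t_1)}\mathcal L_I e^{\mathcal L_0(t_1-t)}\big),$$ $$\grave{\mathfrak M}_k(t)=\int_{t_0}^t dt_{k-1}\cdots\int_{t_0}^{t_2}dt_1\,\mathfrak P\big(\mathcal L_I e^{\mathcal L_0(t-t_{k-1})}\cdots e^{\mathcal L_0(t_2-t_1)}\mathcal L_I e^{\mathcal L_0(t_1-t)}\big)$$ (in particular $\grave{\mathfrak M}_1(t)=\mathfrak P(\mathcal L_I)$). (3) For every $k\ge1$, $\mathfrak M_k$ is differentiable at $t$ and $$\grave{\mathfrak M}_k(t)=\frac{d}{dt}\mathfrak M_k(t)-[\mathcal L_0,\mathfrak M_k(t)],\qquad [A,B]=AB-BA .$$ -/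

import Mathlib

open Filter Topology Asymptotics
open scoped Matrix.Norms.L2Operator

noncomputable section

namespace SuperMaster

/-- Superoperators: the linear maps on the space of complex `d × d` matrices.
(Linear maps between finite-dimensional spaces are automatically continuous.) -/
def Superop (d : ℕ) : Type :=
  Matrix (Fin d) (Fin d) ℂ →L[ℂ] Matrix (Fin d) (Fin d) ℂ

/-- Superoperators form a ring under addition and composition, with the operator norm. All norms
on this finite-dimensional space are equivalent, so the norm only serves to give a meaning to
exponentials, derivatives and integrals. -/
instance (d : ℕ) : NormedRing (Superop d) :=
  inferInstanceAs (NormedRing (Matrix (Fin d) (Fin d) ℂ →L[ℂ] Matrix (Fin d) (Fin d) ℂ))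

instance (d : ℕ) : NormedAlgebra ℂ (Superop d) :=
  inferInstanceAs (NormedAlgebra ℂ (Matrix (Fin d) (Fin d) ℂ →L[ℂ] Matrix (Fin d) (Fin d) ℂ))

instance (d : ℕ) : FiniteDimensional ℂ (Superop d) :=
  inferInstanceAs
    (FiniteDimensional ℂ (Matrix (Fin d) (Fin d) ℂ →L[ℂ] Matrix (Fin d) (Fin d) ℂ))

instance (d : ℕ) : CompleteSpace (Superop d) :=
  FiniteDimensional.complete ℂ (Superop d)

variable {d : ℕ}

/-- `U` is the solution `t ↦ U t` of the Cauchy problem `dU/dt = G U`, `U(t₀) = I`,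
where `I` is the identity superoperator. -/
def IsPropagator (G : Superop d) (t₀ : ℝ) (U : ℝ → Superop d) : Prop :=
  U t₀ = 1 ∧ ∀ t : ℝ, HasDerivAt U (G * U t) t

/-- The free dynamics `e^{t L₀}`. -/
def freeDyn (L₀ : Superop d) (t : ℝ) : Superop d :=
  NormedSpace.exp (t • L₀)

/-- A hyperprojector: a linear idempotent map from superoperators to superoperators. -/
def IsHyperprojector (P : Superop d →ₗ[ℂ] Superop d) : Prop :=
  ∀ Ψ : Superop d, P (P Ψ) = P Ψ

/-- The hyperprojector commutes with left and right multiplication by the free dynamics. -/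
def CommutesWithFree (P : Superop d →ₗ[ℂ] Superop d) (L₀ : Superop d) : Prop :=
  ∀ (t : ℝ) (Ψ : Superop d),
    P (freeDyn L₀ t * Ψ) = freeDyn L₀ t * P Ψ ∧ P (Ψ * freeDyn L₀ t) = P Ψ * freeDyn L₀ t

/-- The propagator in the interaction picture, `Φ_I(t) = e^{-(t - t₀) L₀} Φ(t)`. -/
def interactionPicture (L₀ : Superop d) (t₀ : ℝ) (U : ℝ → Superop d) (t : ℝ) : Superop d :=
  freeDyn L₀ (-(t - t₀)) * U t

/-- The time-local generator of a superoperator-valued function: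
`K(t) = (dV/dt)(t) V(t)⁻¹`, so that `dV/dt = K V` as soon as `V` is differentiable at `t` and
`V t` is invertible. -/
def timeLocalGenerator (V : ℝ → Superop d) (t : ℝ) : Superop d :=
  deriv V t * Ring.inverse (V t)

/-- The Schrödinger-picture generator
`K(t) = L₀ + e^{(t - t₀) L₀} K^I(t) e^{-(t - t₀) L₀}`, where `K^I` is the time-local generator of
the projected interaction-picture propagator `P(Φ_I)`. -/
def masterGenerator (P : Superop d →ₗ[ℂ] Superop d) (L₀ : Superop d) (t₀ : ℝ)
    (U : ℝ → Superop d) (t : ℝ) : Superop d :=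
  L₀ + freeDyn L₀ (t - t₀) *
    timeLocalGenerator (fun s => P (interactionPicture L₀ t₀ U s)) t * freeDyn L₀ (-(t - t₀))

/-- The iterated integral
`∫_{t₀}^t dt_k ∫_{t₀}^{t_k} dt_{k-1} … ∫_{t₀}^{t₂} dt₁ f(t₁, …, t_k)`
(the value `f()` for `k = 0`); the coordinate `τ j` of the argument of `f` is `t_{j+1}`. -/
def iterInt (t₀ : ℝ) : (k : ℕ) → ((Fin k → ℝ) → Superop d) → ℝ → Superop d
  | 0, f, _ => f Fin.elim0
  | k + 1, f, t => ∫ s in t₀..t, iterInt t₀ k (fun τ => f (Fin.snoc τ s)) s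

/-- The product
`e^{(s - t_k) L₀} L_I e^{(t_k - t_{k-1}) L₀} L_I ⋯ e^{(t₂ - t₁) L₀} L_I e^{(t₁ - t) L₀}`
(equal to `e^{(s - t) L₀}` for `k = 0`), where `t_{j+1} = τ j`. -/
def chain (L₀ LI : Superop d) (t : ℝ) : (k : ℕ) → (Fin k → ℝ) → ℝ → Superop d
  | 0, _, s => freeDyn L₀ (s - t)
  | k + 1, τ, s =>
      freeDyn L₀ (s - τ (Fin.last k)) * LI * chain L₀ LI t k (Fin.init τ) (τ (Fin.last k))

/-- The Schrödinger-picture moment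
`M_k(t) = ∫_{t₀}^t dt_k … ∫_{t₀}^{t₂} dt₁
  P(e^{(t - t_k) L₀} L_I e^{(t_k - t_{k-1}) L₀} ⋯ e^{(t₂ - t₁) L₀} L_I e^{(t₁ - t) L₀})`. -/
def moment (P : Superop d →ₗ[ℂ] Superop d) (L₀ LI : Superop d) (t₀ : ℝ) (k : ℕ) (t : ℝ) :
    Superop d :=
  iterInt t₀ k (fun τ => P (chain L₀ LI t k τ t)) t

/-- The moment with a grave accent, for `k ≥ 1`:
`M̀_k(t) = ∫_{t₀}^t dt_{k-1} … ∫_{t₀}^{t₂} dt₁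
  P(L_I e^{(t - t_{k-1}) L₀} L_I ⋯ e^{(t₂ - t₁) L₀} L_I e^{(t₁ - t) L₀})`,
so that `M̀_1 = P(L_I)`. The value at `k = 0` is never used. -/
def graveMoment (P : Superop d →ₗ[ℂ] Superop d) (L₀ LI : Superop d) (t₀ : ℝ) :
    ℕ → ℝ → Superop d
  | 0, _ => 0
  | k + 1, t => iterInt t₀ k (fun τ => P (LI * chain L₀ LI t k τ t)) t

/-- The coefficients of the expansion: `K_0(t) = L₀` and, for `n ≥ 1`,
`K_n(t) = ∑_{q=0}^{n-1} (-1)^q ∑_{k_0 + ⋯ + k_q = n, k_j ≥ 1}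
  M̀_{k_0}(t) M_{k_1}(t) ⋯ M_{k_q}(t)`. -/
def cumulant (P : Superop d →ₗ[ℂ] Superop d) (L₀ LI : Superop d) (t₀ : ℝ) :
    ℕ → ℝ → Superop d
  | 0, _ => L₀
  | n + 1, t =>
      ∑ q ∈ Finset.range (n + 1), (-1 : ℂ) ^ q •
        ∑ k ∈ (Finset.Nat.antidiagonalTuple (q + 1) (n + 1)).filter (fun k => ∀ j, 1 ≤ k j),
          graveMoment P L₀ LI t₀ (k 0) t *
            (List.ofFn fun j : Fin q => moment P L₀ LI t₀ (k j.succ) t).prod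

end SuperMaster

end

/-! Write `F` for `freeDyn L₀ (t - t₀)`. Since `P` commutes with the free dynamics, conjugation by
`F` turns the moments into projected Dyson terms: `M_k = F P(D_k) F⁻¹` and `M̀_k = F P(A D_{k-1})
F⁻¹`, where `A` is the interaction-picture perturbation and `D_k' = A D_{k-1}` (`moment_eq`,
`graveMoment_succ_eq`). Part (3) is then the product rule.

For (2), `K - L₀ = W V⁻¹`, where `V = F P(Φ_I) F⁻¹` and `W = F P(Φ_I)' F⁻¹`. The Dyson expansion of
`Φ_I` gives `V ~ 1 + ∑ λ^k M_k` and `W ~ ∑ λ^k M̀_k`. The cumulants are the coefficients of the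
formal noncommutative quotient `∑_q (-1)^q G M^q = G (1 + M)⁻¹` (`sum_antidiagonal_cumulant_mul`),
and `isBigO_sub_sum_of_mul_eq` transfers this quotient to asymptotic expansions. Part (1) holds
because `P(Φ_I) → P(1) = 1` and units are open. -/

noncomputable section

namespace SuperMaster

/-! ### Ordered cumulants as a quotient of noncommutative power series. -/

section Combinatorics

variable {R : Type*} [Ring R]

theorem sum_antidiagonalTuple_succ {M : Type*} [AddCommMonoid M] (q n : ℕ)
    (f : (Fin (q + 1) → ℕ) → M) :
    ∑ k ∈ Finset.Nat.antidiagonalTuple (q + 1) n, f k =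
      ∑ p ∈ Finset.HasAntidiagonal.antidiagonal n, ∑ k ∈ Finset.Nat.antidiagonalTuple q p.2,
        f (Fin.cons p.1 k) := by
  rw [Finset.sum_sigma']
  symm
  refine Finset.sum_bij' (fun x _ => Fin.cons x.1.1 x.2)
    (fun k _ => ⟨(k 0, ∑ j, Fin.tail k j), Fin.tail k⟩) ?_ ?_ ?_ ?_ ?_
  · rintro ⟨⟨i, j⟩, k⟩ h
    simp only [Finset.mem_sigma, Finset.HasAntidiagonal.mem_antidiagonal,
      Finset.Nat.mem_antidiagonalTuple, Fin.sum_cons] at h ⊢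
    omega
  · intro k h
    simp only [Finset.mem_sigma, Finset.HasAntidiagonal.mem_antidiagonal,
      Finset.Nat.mem_antidiagonalTuple, and_true] at h ⊢
    rw [← h, Fin.sum_univ_succ]
    rfl
  · rintro ⟨⟨i, j⟩, k⟩ h
    simp only [Finset.mem_sigma, Finset.HasAntidiagonal.mem_antidiagonal,
      Finset.Nat.mem_antidiagonalTuple] at h
    obtain ⟨-, rfl⟩ := h
    simp
  · intro k h
    simp
  · intros; rfl

theorem sum_antidiagonalTuple_prod (p : ℕ → R) (q n : ℕ) :
    ∑ k ∈ Finset.Nat.antidiagonalTuple q n, (List.ofFn fun j => p (k j)).prod =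
      PowerSeries.coeff n (PowerSeries.mk p ^ q) := by
  induction q generalizing n with
  | zero => cases n <;> simp [PowerSeries.coeff_one]
  | succ q ih =>
    rw [sum_antidiagonalTuple_succ, pow_succ', PowerSeries.coeff_mul]
    refine Finset.sum_congr rfl fun x _ => ?_
    rw [← ih, Finset.mul_sum, PowerSeries.coeff_mk]
    simp [List.ofFn_succ]

/-- Each of the `q + 1` factors has zero constant term, so the product starts in degree at least `q
+ 1`. -/
theorem coeff_mul_mk_pow_eq_zero {g m : ℕ → R} (hg : g 0 = 0) (hm : m 0 = 0) {q n : ℕ}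
    (h : n ≤ q) : PowerSeries.coeff n (PowerSeries.mk g * PowerSeries.mk m ^ q) = 0 := by
  induction q generalizing n with
  | zero => simp_all
  | succ q ih =>
    rw [pow_succ, ← mul_assoc, PowerSeries.coeff_mul]
    refine Finset.sum_eq_zero fun x hx => ?_
    rw [Finset.HasAntidiagonal.mem_antidiagonal] at hx
    rcases Nat.eq_zero_or_pos x.2 with h2 | h2
    · simp [h2, hm]
    · rw [ih (by omega), zero_mul]

/-- The constraint `k_j ≥ 1` amounts to removing constant terms: for `g` it is the hypothesis `hg`,
for `m` the constant term is replaced by zero. -/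
theorem sum_filter_antidiagonalTuple_prod (g m : ℕ → R) (hg : g 0 = 0) (q n : ℕ) :
    ∑ k ∈ (Finset.Nat.antidiagonalTuple (q + 1) n).filter (fun k => ∀ j, 1 ≤ k j),
        g (k 0) * (List.ofFn fun j : Fin q => m (k j.succ)).prod =
      PowerSeries.coeff n
        (PowerSeries.mk g * PowerSeries.mk (fun i => if i = 0 then 0 else m i) ^ q) := by
  have h : ∀ k ∈ Finset.Nat.antidiagonalTuple (q + 1) n,
      (if ∀ j, 1 ≤ k j then g (k 0) * (List.ofFn fun j : Fin q => m (k j.succ)).prod else 0) =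
        g (k 0) * (List.ofFn fun j : Fin q => if k j.succ = 0 then 0 else m (k j.succ)).prod := by
    intro k _
    split_ifs with hk
    · have : ∀ j : Fin q, k j.succ ≠ 0 := fun j => Nat.one_le_iff_ne_zero.mp (hk j.succ)
      simp [this]
    · push Not at hk
      obtain ⟨j, hj⟩ := hk
      obtain rfl | ⟨i, rfl⟩ := j.eq_zero_or_eq_succ
      · rw [Nat.lt_one_iff.mp hj, hg, zero_mul]
      · rw [List.prod_eq_zero, mul_zero]
        rw [List.mem_ofFn]
        exact ⟨i, by simp [Nat.lt_one_iff.mp hj]⟩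
  rw [Finset.sum_filter, Finset.sum_congr rfl h, sum_antidiagonalTuple_succ, PowerSeries.coeff_mul]
  refine Finset.sum_congr rfl fun x _ => ?_
  rw [← sum_antidiagonalTuple_prod, Finset.mul_sum]
  simp

/-- The ordered expansion `∑_q (-1)^q ∑ g_{k_0} m_{k_1} ⋯ m_{k_q}` inverts the convolution with
`m`, where `m_0 = 1`. -/
theorem sum_antidiagonal_cumulant_mul [Algebra ℂ R] (g m c : ℕ → R) (hg : g 0 = 0) (hm : m 0 = 1)
    (hc : ∀ n, c n = ∑ q ∈ Finset.range n, (-1 : ℂ) ^ q •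
      ∑ k ∈ (Finset.Nat.antidiagonalTuple (q + 1) n).filter (fun k => ∀ j, 1 ≤ k j),
        g (k 0) * (List.ofFn fun j : Fin q => m (k j.succ)).prod) (n : ℕ) :
    ∑ p ∈ Finset.HasAntidiagonal.antidiagonal n, c p.1 * m p.2 = g n := by
  set G := PowerSeries.mk g
  set M := PowerSeries.mk (fun i => if i = 0 then 0 else m i)
  have hM : PowerSeries.mk m = 1 - -M := by
    ext i
    by_cases hi : i = 0 <;> simp [M, hi, hm, PowerSeries.coeff_one]
  have hneg : ∀ (q i : ℕ), i ≤ q → PowerSeries.coeff i (G * (-M) ^ q) = 0 := by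
    intro q i hi
    have h0 := coeff_mul_mk_pow_eq_zero (g := g) (m := fun i => if i = 0 then 0 else m i)
      hg (if_pos rfl) hi
    rcases Nat.even_or_odd q with h | h <;> simp [h.neg_pow, h0, G, M]
  -- One finite geometric sum serves all `i ≤ n`, because the terms with `q ≥ i` do not contribute
  -- in degree `i`.
  have hC : ∀ i ≤ n, c i = PowerSeries.coeff i (G * ∑ q ∈ Finset.range (n + 1), (-M) ^ q) := by
    intro i hi
    rw [hc, Finset.mul_sum, map_sum]
    rw [← Finset.sum_subset (s₁ := Finset.range i)
      (Finset.range_subset_range.mpr (by omega)) (fun q _ hq => hneg q i (by simpa using hq))]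
    refine Finset.sum_congr rfl fun q _ => ?_
    rw [sum_filter_antidiagonalTuple_prod g m hg]
    rcases Nat.even_or_odd q with h | h <;> simp [h.neg_pow, G, M]
  have h1 : ∑ p ∈ Finset.HasAntidiagonal.antidiagonal n, c p.1 * m p.2 =
      PowerSeries.coeff n ((G * ∑ q ∈ Finset.range (n + 1), (-M) ^ q) * PowerSeries.mk m) := by
    rw [PowerSeries.coeff_mul]
    refine Finset.sum_congr rfl fun p hp => ?_
    rw [hC p.1 (by have := Finset.HasAntidiagonal.mem_antidiagonal.mp hp; omega), PowerSeries.coeff_mk]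
  -- The product telescopes to `G - G (-M)^(n+1)`, whose second term vanishes in degree `n`.
  rw [h1, hM, mul_assoc, geom_sum_mul_neg, mul_sub, mul_one, map_sub,
    hneg _ _ (Nat.le_succ n), sub_zero, PowerSeries.coeff_mk]

end Combinatorics

/-! ### Products and quotients of asymptotic expansions. -/

section Asymptotics

variable {R : Type*} [NormedRing R] [NormedAlgebra ℂ R]

theorem isBigO_pow_smul_const (a : R) {k N : ℕ} (h : N ≤ k) :
    (fun z : ℂ => z ^ k • a) =O[𝓝 (0 : ℂ)] fun z : ℂ => z ^ N := by
  obtain ⟨j, rfl⟩ := Nat.exists_eq_add_of_le h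
  have : (fun z : ℂ => z ^ j • a) =O[𝓝 (0 : ℂ)] fun _ => (1 : ℂ) := by
    have hc : ContinuousAt (fun z : ℂ => z ^ j • a) 0 := by fun_prop
    exact hc.isBigO_one ℂ
  simpa [pow_add, mul_smul] using (isBigO_refl (fun z : ℂ => z ^ N) (𝓝 0)).smul this

/-- Only the monomials of total degree above `N` survive the subtraction. -/
theorem isBigO_mul_sum_sub_sum_antidiagonal (a b : ℕ → R) (N : ℕ) :
    (fun z : ℂ => (∑ i ∈ Finset.range (N + 1), z ^ i • a i) *
        (∑ j ∈ Finset.range (N + 1), z ^ j • b j) -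
      ∑ n ∈ Finset.range (N + 1), z ^ n • ∑ p ∈ Finset.HasAntidiagonal.antidiagonal n, a p.1 * b p.2)
      =O[𝓝 (0 : ℂ)] fun z : ℂ => z ^ (N + 1) := by
  have key : ∀ z : ℂ, (∑ i ∈ Finset.range (N + 1), z ^ i • a i) *
        (∑ j ∈ Finset.range (N + 1), z ^ j • b j) -
      ∑ n ∈ Finset.range (N + 1), z ^ n • ∑ p ∈ Finset.HasAntidiagonal.antidiagonal n, a p.1 * b p.2 =
      ∑ p ∈ (Finset.range (N + 1) ×ˢ Finset.range (N + 1)).filter (fun p => ¬ p.1 + p.2 ≤ N),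
        z ^ (p.1 + p.2) • (a p.1 * b p.2) := by
    intro z
    rw [Finset.sum_mul_sum, ← Finset.sum_product', sub_eq_iff_eq_add',
      ← Finset.sum_filter_add_sum_filter_not _ (fun p : ℕ × ℕ => p.1 + p.2 ≤ N)]
    simp only [smul_mul_smul_comm, ← pow_add]
    congr 1
    simp only [Finset.smul_sum]
    rw [Finset.sum_sigma']
    refine Finset.sum_bij' (fun p _ => ⟨p.1 + p.2, p⟩) (fun x _ => x.2) ?_ ?_ ?_ ?_ ?_
    · intro p; simp +contextual
    · rintro ⟨n, p⟩; simp +contextual; omega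
    · intros; rfl
    · rintro ⟨n, p⟩ h
      simp only [Finset.mem_sigma, Finset.HasAntidiagonal.mem_antidiagonal] at h
      obtain ⟨-, rfl⟩ := h
      rfl
    · intros; rfl
  simp only [key]
  refine IsBigO.fun_sum fun p hp => isBigO_pow_smul_const _ ?_
  simp only [Finset.mem_filter] at hp
  omega

/-- The asymptotic expansion of a right quotient of two functions with asymptotic expansions. -/
theorem isBigO_sub_sum_of_mul_eq {K V W : ℂ → R} {c m g : ℕ → R} {N : ℕ}
    (hV : (fun z => V z - ∑ n ∈ Finset.range (N + 1), z ^ n • m n)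
      =O[𝓝 (0 : ℂ)] fun z : ℂ => z ^ (N + 1))
    (hW : (fun z => W z - ∑ n ∈ Finset.range (N + 1), z ^ n • g n)
      =O[𝓝 (0 : ℂ)] fun z : ℂ => z ^ (N + 1))
    (hKV : ∀ᶠ z in 𝓝 (0 : ℂ), K z * V z = W z)
    (hV_one : Tendsto V (𝓝 0) (𝓝 1)) [CompleteSpace R]
    (hc : ∀ n, ∑ p ∈ Finset.HasAntidiagonal.antidiagonal n, c p.1 * m p.2 = g n) :
    (fun z => K z - ∑ n ∈ Finset.range (N + 1), z ^ n • c n)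
      =O[𝓝 (0 : ℂ)] fun z : ℂ => z ^ (N + 1) := by
  set C : ℂ → R := fun z => ∑ n ∈ Finset.range (N + 1), z ^ n • c n with hCdef
  have hC : C =O[𝓝 (0 : ℂ)] fun _ => (1 : ℂ) := by
    have : ContinuousAt C 0 := by fun_prop
    exact this.isBigO_one ℂ
  have hinv : (fun z => Ring.inverse (V z)) =O[𝓝 (0 : ℂ)] fun _ => (1 : ℂ) := by
    have h := (NormedRing.inverse_continuousAt (1 : Rˣ)).tendsto
    exact (h.comp hV_one).isBigO_one ℂ
  have hunit : ∀ᶠ z in 𝓝 (0 : ℂ), IsUnit (V z) :=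
    hV_one.eventually (Units.isOpen.mem_nhds isUnit_one)
  have h1 : (fun z => C z * (V z - ∑ n ∈ Finset.range (N + 1), z ^ n • m n))
      =O[𝓝 (0 : ℂ)] fun z : ℂ => z ^ (N + 1) := by
    simpa using hC.mul hV
  have h2 := isBigO_mul_sum_sub_sum_antidiagonal c m N
  simp only [hc] at h2
  -- The three errors combine to `(K - C) V`; multiplying by the bounded inverse of `V` isolates `K
  -- - C`.
  have h3 := ((hW.sub h1).sub h2).mul hinv
  simp only [mul_one] at h3
  refine h3.congr' ?_ EventuallyEq.rfl
  filter_upwards [hKV, hunit] with z hz hu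
  rw [← hz, mul_sub]
  change (_ - _ - (C z * _ - ∑ n ∈ Finset.range (N + 1), z ^ n • g n)) * _ = K z - C z
  rw [show K z * V z - ∑ n ∈ Finset.range (N + 1), z ^ n • g n -
      (C z * V z - C z * ∑ n ∈ Finset.range (N + 1), z ^ n • m n) -
      (C z * ∑ n ∈ Finset.range (N + 1), z ^ n • m n -
        ∑ n ∈ Finset.range (N + 1), z ^ n • g n) = (K z - C z) * V z by
    rw [sub_mul]; abel, mul_assoc, Ring.mul_inverse_cancel _ hu, mul_one]

end Asymptotics

variable {d : ℕ}

/-! ### The one-parameter group generated by a superoperator. -/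

section FreeDynamics

variable (L : Superop d)

theorem freeDyn_zero : freeDyn L 0 = 1 := by
  simp [freeDyn, NormedSpace.exp_zero]

theorem freeDyn_add (s t : ℝ) : freeDyn L (s + t) = freeDyn L s * freeDyn L t := by
  let _ : NormedAlgebra ℚ (Superop d) := NormedAlgebra.restrictScalars ℚ ℂ (Superop d)
  rw [freeDyn, add_smul, NormedSpace.exp_add_of_commute]
  · rfl
  · exact ((Commute.refl L).smul_left s).smul_right t

theorem freeDyn_mul_neg (s : ℝ) : freeDyn L s * freeDyn L (-s) = 1 := by
  rw [← freeDyn_add, add_neg_cancel, freeDyn_zero]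

theorem freeDyn_neg_mul (s : ℝ) : freeDyn L (-s) * freeDyn L s = 1 := by
  rw [← freeDyn_add, neg_add_cancel, freeDyn_zero]

theorem freeDyn_mul_neg_mul (s : ℝ) (Ψ : Superop d) :
    freeDyn L s * (freeDyn L (-s) * Ψ) = Ψ := by
  rw [← mul_assoc, freeDyn_mul_neg, one_mul]

theorem freeDyn_neg_mul_mul (s : ℝ) (Ψ : Superop d) :
    freeDyn L (-s) * (freeDyn L s * Ψ) = Ψ := by
  rw [← mul_assoc, freeDyn_neg_mul, one_mul]

theorem isUnit_freeDyn (s : ℝ) : IsUnit (freeDyn L s) :=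
  ⟨⟨freeDyn L s, freeDyn L (-s), freeDyn_mul_neg L s, freeDyn_neg_mul L s⟩, rfl⟩

theorem hasDerivAt_freeDyn (s : ℝ) : HasDerivAt (freeDyn L) (L * freeDyn L s) s :=
  hasDerivAt_exp_smul_const' (𝕂 := ℝ) L s

theorem hasDerivAt_freeDyn' (s : ℝ) : HasDerivAt (freeDyn L) (freeDyn L s * L) s :=
  hasDerivAt_exp_smul_const (𝕂 := ℝ) L s

theorem hasDerivAt_freeDyn_sub (t₀ s : ℝ) :
    HasDerivAt (fun s => freeDyn L (s - t₀)) (L * freeDyn L (s - t₀)) s :=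
  (hasDerivAt_freeDyn L (s - t₀)).comp_sub_const s t₀

theorem hasDerivAt_freeDyn_neg_sub (t₀ s : ℝ) :
    HasDerivAt (fun s => freeDyn L (-(s - t₀))) (-(freeDyn L (-(s - t₀)) * L)) s :=
  HasDerivAt.congr_deriv (HasDerivAt.scomp (h := fun s => -(s - t₀)) s
    (hasDerivAt_freeDyn' L (-(s - t₀))) ((hasDerivAt_id s).sub_const t₀).neg)
    (neg_one_smul ℝ _)

theorem continuous_freeDyn : Continuous (freeDyn L) :=
  continuous_iff_continuousAt.mpr fun s => (hasDerivAt_freeDyn L s).continuousAt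

end FreeDynamics

/-- Uniqueness for the Cauchy problem: `e^{-(s - t₀) G} U(s)` has zero derivative. The explicit
exponential supplies joint continuity in `λ` and time. -/
theorem IsPropagator.eq_freeDyn {G : Superop d} {t₀ : ℝ} {U : ℝ → Superop d}
    (hU : IsPropagator G t₀ U) (s : ℝ) : U s = freeDyn G (s - t₀) := by
  have hd : ∀ r, HasDerivAt (fun r => freeDyn G (-(r - t₀)) * U r) 0 r := by
    intro r
    refine ((hasDerivAt_freeDyn_neg_sub G t₀ r).mul (hU.2 r)).congr_deriv ?_
    rw [neg_mul, mul_assoc, neg_add_cancel]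
  have h := is_const_of_deriv_eq_zero (fun r => (hd r).differentiableAt)
    (fun r => (hd r).deriv) s t₀
  simp only [sub_self, neg_zero, freeDyn_zero, one_mul, hU.1] at h
  rw [← freeDyn_mul_neg_mul G (s - t₀) (U s), h, mul_one]

/-! ### Dyson terms and their relation to the moments. -/

/-- The perturbation in the interaction picture. -/
def interactionGenerator (L₀ LI : Superop d) (t₀ s : ℝ) : Superop d :=
  freeDyn L₀ (-(s - t₀)) * LI * freeDyn L₀ (s - t₀)

theorem continuous_interactionGenerator (L₀ LI : Superop d) (t₀ : ℝ) :
    Continuous (interactionGenerator L₀ LI t₀) := by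
  have := continuous_freeDyn L₀
  unfold interactionGenerator
  fun_prop

theorem hasDerivAt_interactionPicture {L₀ LI : Superop d} {t₀ : ℝ} {lam : ℂ}
    {U : ℝ → Superop d} (hU : IsPropagator (L₀ + lam • LI) t₀ U) (s : ℝ) :
    HasDerivAt (interactionPicture L₀ t₀ U)
      (lam • (interactionGenerator L₀ LI t₀ s * interactionPicture L₀ t₀ U s)) s := by
  refine ((hasDerivAt_freeDyn_neg_sub L₀ t₀ s).mul (hU.2 s)).congr_deriv ?_
  simp only [interactionGenerator, interactionPicture, mul_assoc, freeDyn_mul_neg_mul]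
  simp [add_mul, mul_add, mul_assoc]

/-- The terms of the Dyson series of the interaction-picture propagator. -/
def dysonTerm (L₀ LI : Superop d) (t₀ : ℝ) : ℕ → ℝ → Superop d
  | 0, _ => 1
  | k + 1, t => ∫ s in t₀..t, interactionGenerator L₀ LI t₀ s * dysonTerm L₀ LI t₀ k s

theorem continuous_dysonTerm (L₀ LI : Superop d) (t₀ : ℝ) (k : ℕ) :
    Continuous (dysonTerm L₀ LI t₀ k) := by
  induction k with
  | zero => exact continuous_const
  | succ k ih =>
    have := continuous_interactionGenerator L₀ LI t₀
    exact intervalIntegral.continuous_primitive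
      (fun a b => (this.mul ih).intervalIntegrable a b) t₀

theorem hasDerivAt_dysonTerm_succ (L₀ LI : Superop d) (t₀ : ℝ) (k : ℕ) (t : ℝ) :
    HasDerivAt (dysonTerm L₀ LI t₀ (k + 1))
      (interactionGenerator L₀ LI t₀ t * dysonTerm L₀ LI t₀ k t) t :=
  ((continuous_interactionGenerator L₀ LI t₀).mul
    (continuous_dysonTerm L₀ LI t₀ k)).integral_hasStrictDerivAt t₀ t |>.hasDerivAt

/-- The integrand of the Dyson terms: a time-ordered product of interaction-picture
perturbations. -/
def dysonIntegrand (L₀ LI : Superop d) (t₀ : ℝ) : (k : ℕ) → (Fin k → ℝ) → Superop d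
  | 0, _ => 1
  | k + 1, τ => interactionGenerator L₀ LI t₀ (τ (Fin.last k)) *
      dysonIntegrand L₀ LI t₀ k (Fin.init τ)

/-- Splitting each time difference at `t₀` gives every `L_I` its own pair of conjugating
exponentials. -/
theorem chain_eq (L₀ LI : Superop d) (t₀ t : ℝ) (k : ℕ) (τ : Fin k → ℝ) (s : ℝ) :
    chain L₀ LI t k τ s =
      freeDyn L₀ (s - t₀) * dysonIntegrand L₀ LI t₀ k τ * freeDyn L₀ (-(t - t₀)) := by
  induction k generalizing s with
  | zero =>
    rw [chain, dysonIntegrand, mul_one, ← freeDyn_add]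
    congr 1
    ring
  | succ k ih =>
    rw [chain, dysonIntegrand, ih, interactionGenerator,
      show s - τ (Fin.last k) = (s - t₀) + -(τ (Fin.last k) - t₀) by ring, freeDyn_add]
    simp only [mul_assoc]

theorem iterInt_dysonIntegrand (L₀ LI : Superop d) (t₀ : ℝ) (k : ℕ)
    (Q : Superop d →L[ℝ] Superop d) (t : ℝ) :
    iterInt t₀ k (fun τ => Q (dysonIntegrand L₀ LI t₀ k τ)) t = Q (dysonTerm L₀ LI t₀ k t) := by
  induction k generalizing t Q with
  | zero => rfl
  | succ k ih =>
    rw [iterInt, dysonTerm, ← ContinuousLinearMap.intervalIntegral_comp_comm]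
    · refine intervalIntegral.integral_congr fun s _ => ?_
      simp only [dysonIntegrand, Fin.snoc_last, Fin.init_snoc]
      -- The factor at the outermost time is absorbed into `Q`, which is why the induction runs over
      -- all `Q`.
      exact ih (Q.comp (ContinuousLinearMap.mul ℝ _ (interactionGenerator L₀ LI t₀ s))) s
    · exact ((continuous_interactionGenerator L₀ LI t₀).mul
        (continuous_dysonTerm L₀ LI t₀ k)).intervalIntegrable _ _

theorem CommutesWithFree.map_conj {P : Superop d →ₗ[ℂ] Superop d} {L₀ : Superop d}
    (h : CommutesWithFree P L₀) (s r : ℝ) (Ψ : Superop d) :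
    P (freeDyn L₀ s * Ψ * freeDyn L₀ r) = freeDyn L₀ s * P Ψ * freeDyn L₀ r := by
  rw [(h r _).2, (h s _).1]

/-- A linear map on superoperators as a continuous real-linear map. -/
def toRealCLM (P : Superop d →ₗ[ℂ] Superop d) : Superop d →L[ℝ] Superop d :=
  (LinearMap.toContinuousLinearMap P).restrictScalars ℝ

theorem hasDerivAt_map (P : Superop d →ₗ[ℂ] Superop d) {f : ℝ → Superop d} {f' : Superop d}
    {t : ℝ} (hf : HasDerivAt f f' t) : HasDerivAt (fun s => P (f s)) (P f') t :=
  (toRealCLM P).hasFDerivAt.comp_hasDerivAt t hf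

theorem moment_eq {P : Superop d →ₗ[ℂ] Superop d} {L₀ : Superop d} (h : CommutesWithFree P L₀)
    (LI : Superop d) (t₀ : ℝ) (k : ℕ) (t : ℝ) :
    moment P L₀ LI t₀ k t =
      freeDyn L₀ (t - t₀) * P (dysonTerm L₀ LI t₀ k t) * freeDyn L₀ (-(t - t₀)) := by
  simp only [moment, chain_eq L₀ LI t₀, h.map_conj]
  exact iterInt_dysonIntegrand L₀ LI t₀ k
    (((ContinuousLinearMap.mul ℝ _).flip (freeDyn L₀ (-(t - t₀)))).comp
      ((ContinuousLinearMap.mul ℝ _ (freeDyn L₀ (t - t₀))).comp (toRealCLM P))) t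

theorem graveMoment_succ_eq {P : Superop d →ₗ[ℂ] Superop d} {L₀ : Superop d}
    (h : CommutesWithFree P L₀) (LI : Superop d) (t₀ : ℝ) (k : ℕ) (t : ℝ) :
    graveMoment P L₀ LI t₀ (k + 1) t =
      freeDyn L₀ (t - t₀) * P (interactionGenerator L₀ LI t₀ t * dysonTerm L₀ LI t₀ k t) *
        freeDyn L₀ (-(t - t₀)) := by
  have hLI : ∀ Ψ : Superop d, LI * (freeDyn L₀ (t - t₀) * Ψ * freeDyn L₀ (-(t - t₀))) =
      freeDyn L₀ (t - t₀) * (interactionGenerator L₀ LI t₀ t * Ψ) * freeDyn L₀ (-(t - t₀)) := by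
    intro Ψ
    simp only [interactionGenerator, mul_assoc, freeDyn_mul_neg_mul]
  simp only [graveMoment, chain_eq L₀ LI t₀, hLI, h.map_conj]
  exact iterInt_dysonIntegrand L₀ LI t₀ k
    (((ContinuousLinearMap.mul ℝ _).flip (freeDyn L₀ (-(t - t₀)))).comp
      ((ContinuousLinearMap.mul ℝ _ (freeDyn L₀ (t - t₀))).comp ((toRealCLM P).comp
        (ContinuousLinearMap.mul ℝ _ (interactionGenerator L₀ LI t₀ t))))) t

theorem moment_zero {P : Superop d →ₗ[ℂ] Superop d} (hP_one : P 1 = 1) (L₀ LI : Superop d)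
    (t₀ t : ℝ) : moment P L₀ LI t₀ 0 t = 1 := by
  simp [moment, iterInt, chain, freeDyn_zero, hP_one]

/-- In `F P(D_{k+1}) F⁻¹`, differentiating the outer factors gives the commutator and
differentiating the Dyson term gives the grave moment. -/
theorem hasDerivAt_moment_succ {P : Superop d →ₗ[ℂ] Superop d} {L₀ : Superop d}
    (h : CommutesWithFree P L₀) (LI : Superop d) (t₀ : ℝ) (k : ℕ) (t : ℝ) :
    HasDerivAt (moment P L₀ LI t₀ (k + 1))
      (graveMoment P L₀ LI t₀ (k + 1) t + ⁅L₀, moment P L₀ LI t₀ (k + 1) t⁆) t := by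
  have h1 := ((hasDerivAt_freeDyn_sub L₀ t₀ t).mul
    (hasDerivAt_map P (hasDerivAt_dysonTerm_succ L₀ LI t₀ k t))).mul
      (hasDerivAt_freeDyn_neg_sub L₀ t₀ t)
  convert h1 using 1
  · funext s
    exact moment_eq h LI t₀ (k + 1) s
  · rw [graveMoment_succ_eq h, moment_eq h, Ring.lie_def]
    simp only [Pi.mul_apply]
    noncomm_ring

/-! ### Remainder estimates for the Dyson series. -/

section DysonExpansion

variable {L₀ LI : Superop d} {t₀ : ℝ} {Φ : ℂ → ℝ → Superop d}

theorem exists_norm_interactionPicture_le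
    (hΦ : ∀ lam : ℂ, IsPropagator (L₀ + lam • LI) t₀ (Φ lam)) (t : ℝ) :
    ∃ C, ∀ lam : ℂ, ‖lam‖ ≤ 1 → ∀ s ∈ Set.uIcc t₀ t,
      ‖interactionPicture L₀ t₀ (Φ lam) s‖ ≤ C := by
  let _ : NormedAlgebra ℚ (Superop d) := NormedAlgebra.restrictScalars ℚ ℂ (Superop d)
  have hcont : Continuous fun x : ℂ × ℝ => freeDyn L₀ (-(x.2 - t₀)) *
      NormedSpace.exp ((x.2 - t₀) • (L₀ + x.1 • LI)) := by
    have h1 := continuous_freeDyn L₀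
    have h2 : Continuous fun x : Superop d => NormedSpace.exp x := NormedSpace.exp_continuous
    fun_prop
  obtain ⟨C, hC⟩ := ((isCompact_closedBall (0 : ℂ) 1).prod
    (isCompact_uIcc (a := t₀) (b := t))).exists_bound_of_continuousOn hcont.continuousOn
  refine ⟨C, fun lam hlam s hs => ?_⟩
  rw [interactionPicture, (hΦ lam).eq_freeDyn]
  exact hC (lam, s) ⟨by simpa using hlam, hs⟩

/-- The remainders satisfy `E_{N+1}' = λ A E_N` and `E_{N+1}(t₀) = 0`, so the mean value inequality
gains one power of `λ` per step. The induction needs the bound uniformly on the segment from `t₀` to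
`t`. -/
theorem exists_norm_interactionPicture_sub_sum_dysonTerm_le
    (hΦ : ∀ lam : ℂ, IsPropagator (L₀ + lam • LI) t₀ (Φ lam)) (t : ℝ) (N : ℕ) :
    ∃ C, ∀ lam : ℂ, ‖lam‖ ≤ 1 → ∀ s ∈ Set.uIcc t₀ t,
      ‖interactionPicture L₀ t₀ (Φ lam) s -
        ∑ k ∈ Finset.range N, lam ^ k • dysonTerm L₀ LI t₀ k s‖ ≤ C * ‖lam‖ ^ N := by
  induction N with
  | zero => simpa using exists_norm_interactionPicture_le hΦ t
  | succ N ih =>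
    obtain ⟨C, hC⟩ := ih
    obtain ⟨B, hB⟩ := (isCompact_uIcc (a := t₀) (b := t)).exists_bound_of_continuousOn
      (continuous_interactionGenerator L₀ LI t₀).continuousOn
    refine ⟨B * C * |t - t₀|, fun lam hlam s hs => ?_⟩
    set E : ℕ → ℝ → Superop d := fun N s => interactionPicture L₀ t₀ (Φ lam) s -
        ∑ k ∈ Finset.range N, lam ^ k • dysonTerm L₀ LI t₀ k s with hE
    have hE0 : E (N + 1) t₀ = 0 := by
      simp [hE, Finset.sum_range_succ', interactionPicture, (hΦ lam).1,
        freeDyn_zero, dysonTerm]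
    have hderiv : ∀ r, HasDerivAt (E (N + 1))
        (lam • (interactionGenerator L₀ LI t₀ r * E N r)) r := by
      intro r
      have h1 : HasDerivAt (fun r => ∑ k ∈ Finset.range N,
          lam ^ (k + 1) • dysonTerm L₀ LI t₀ (k + 1) r)
          (∑ k ∈ Finset.range N, lam ^ (k + 1) •
            (interactionGenerator L₀ LI t₀ r * dysonTerm L₀ LI t₀ k r)) r :=
        HasDerivAt.fun_sum fun k _ =>
          (hasDerivAt_dysonTerm_succ L₀ LI t₀ k r).const_smul (lam ^ (k + 1))
      have h2 := ((hasDerivAt_interactionPicture (hΦ lam) r).sub h1).sub_const 1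
      have h3 : E (N + 1) = fun r => interactionPicture L₀ t₀ (Φ lam) r -
          ∑ k ∈ Finset.range N, lam ^ (k + 1) • dysonTerm L₀ LI t₀ (k + 1) r - 1 := by
        funext r
        simp only [hE, Finset.sum_range_succ', pow_zero, one_smul, sub_sub]
        rfl
      rw [h3]
      refine h2.congr_deriv ?_
      simp [hE, mul_sub, smul_sub, Finset.mul_sum, Finset.smul_sum, smul_smul, pow_succ']
    have hbound : ∀ r ∈ Set.uIcc t₀ t, ‖lam • (interactionGenerator L₀ LI t₀ r * E N r)‖ ≤
        ‖lam‖ * (B * (C * ‖lam‖ ^ N)) := by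
      intro r hr
      rw [norm_smul]
      gcongr
      exact (norm_mul_le _ _).trans (mul_le_mul (hB r hr) (hC lam hlam r hr) (norm_nonneg _)
        ((norm_nonneg _).trans (hB r hr)))
    have h := Convex.norm_image_sub_le_of_norm_hasDerivWithin_le
      (fun r _ => (hderiv r).hasDerivWithinAt) hbound (convex_uIcc t₀ t) Set.left_mem_uIcc hs
    rw [hE0, sub_zero] at h
    calc ‖E (N + 1) s‖ ≤ ‖lam‖ * (B * (C * ‖lam‖ ^ N)) * ‖s - t₀‖ := h
      _ ≤ ‖lam‖ * (B * (C * ‖lam‖ ^ N)) * |t - t₀| := by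
        gcongr
        · exact (norm_nonneg _).trans (hbound t₀ Set.left_mem_uIcc)
        · simpa [abs_sub_comm] using Set.abs_sub_left_of_mem_uIcc hs
      _ = B * C * |t - t₀| * ‖lam‖ ^ (N + 1) := by ring

theorem isBigO_interactionPicture_sub_sum_dysonTerm
    (hΦ : ∀ lam : ℂ, IsPropagator (L₀ + lam • LI) t₀ (Φ lam)) (t : ℝ) (N : ℕ) :
    (fun lam => interactionPicture L₀ t₀ (Φ lam) t -
        ∑ k ∈ Finset.range N, lam ^ k • dysonTerm L₀ LI t₀ k t)
      =O[𝓝 (0 : ℂ)] fun lam : ℂ => lam ^ N := by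
  obtain ⟨C, hC⟩ := exists_norm_interactionPicture_sub_sum_dysonTerm_le hΦ t N
  refine IsBigO.of_bound C ?_
  filter_upwards [Metric.closedBall_mem_nhds (0 : ℂ) one_pos] with lam hlam
  rw [norm_pow]
  exact hC lam (by simpa using hlam) t Set.right_mem_uIcc

end DysonExpansion

/-! ### The projected dynamics and the expansion of its generator. -/

section MasterEquation

variable {P : Superop d →ₗ[ℂ] Superop d} {L₀ LI : Superop d} {t₀ : ℝ}
  {Φ : ℂ → ℝ → Superop d}

theorem isBigO_conj_map {f : ℂ → Superop d} {N : ℕ} (P : Superop d →ₗ[ℂ] Superop d)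
    (A B : Superop d) (hf : f =O[𝓝 (0 : ℂ)] fun lam : ℂ => lam ^ N) :
    (fun lam => A * P (f lam) * B) =O[𝓝 (0 : ℂ)] fun lam : ℂ => lam ^ N :=
  ((((ContinuousLinearMap.mul ℂ _).flip B).comp ((ContinuousLinearMap.mul ℂ _ A).comp
    (LinearMap.toContinuousLinearMap P))).isBigO_comp f _).trans hf

theorem map_eq_freeDyn_mul (hP_comm : CommutesWithFree P L₀) (U : ℝ → Superop d) (s : ℝ) :
    P (U s) = freeDyn L₀ (s - t₀) * P (interactionPicture L₀ t₀ U s) := by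
  rw [← (hP_comm _ _).1, interactionPicture, freeDyn_mul_neg_mul]

theorem isBigO_projected_sub_sum_moment (hP_comm : CommutesWithFree P L₀)
    (hΦ : ∀ lam : ℂ, IsPropagator (L₀ + lam • LI) t₀ (Φ lam)) (t : ℝ) (N : ℕ) :
    (fun lam => freeDyn L₀ (t - t₀) * P (interactionPicture L₀ t₀ (Φ lam) t) *
        freeDyn L₀ (-(t - t₀)) -
        ∑ n ∈ Finset.range N, lam ^ n • moment P L₀ LI t₀ n t)
      =O[𝓝 (0 : ℂ)] fun lam : ℂ => lam ^ N := by
  refine (isBigO_conj_map P (freeDyn L₀ (t - t₀)) (freeDyn L₀ (-(t - t₀)))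
    (isBigO_interactionPicture_sub_sum_dysonTerm hΦ t N)).congr_left fun lam => ?_
  simp [moment_eq hP_comm, mul_sub, sub_mul, Finset.mul_sum, Finset.sum_mul]

/-- The explicit factor `λ` raises the order by one, so `N` Dyson terms suffice; the extra summand
`n = 0` is the default value `0` of `graveMoment`. -/
theorem isBigO_projected_deriv_sub_sum_graveMoment (hP_comm : CommutesWithFree P L₀)
    (hΦ : ∀ lam : ℂ, IsPropagator (L₀ + lam • LI) t₀ (Φ lam)) (t : ℝ) (N : ℕ) :
    (fun lam => freeDyn L₀ (t - t₀) * P (lam • (interactionGenerator L₀ LI t₀ t *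
        interactionPicture L₀ t₀ (Φ lam) t)) * freeDyn L₀ (-(t - t₀)) -
        ∑ n ∈ Finset.range (N + 1), lam ^ n • graveMoment P L₀ LI t₀ n t)
      =O[𝓝 (0 : ℂ)] fun lam : ℂ => lam ^ (N + 1) := by
  have h1 := (isBigO_refl (fun lam : ℂ => lam) (𝓝 0)).smul
    (isBigO_conj_map (P ∘ₗ LinearMap.mulLeft ℂ (interactionGenerator L₀ LI t₀ t))
      (freeDyn L₀ (t - t₀)) (freeDyn L₀ (-(t - t₀)))
      (isBigO_interactionPicture_sub_sum_dysonTerm hΦ t N))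
  simp only [smul_eq_mul, ← pow_succ'] at h1
  refine h1.congr_left fun lam => ?_
  simp [Finset.sum_range_succ', graveMoment_succ_eq hP_comm, graveMoment.eq_1, mul_sub, sub_mul,
    smul_sub, Finset.mul_sum, Finset.sum_mul, Finset.smul_sum, smul_smul, pow_succ']

theorem tendsto_map_interactionPicture (hP_one : P 1 = 1)
    (hΦ : ∀ lam : ℂ, IsPropagator (L₀ + lam • LI) t₀ (Φ lam)) (t : ℝ) :
    Tendsto (fun lam => P (interactionPicture L₀ t₀ (Φ lam) t)) (𝓝 0) (𝓝 1) := by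
  have h := isBigO_interactionPicture_sub_sum_dysonTerm hΦ t 1
  simp only [pow_one, Finset.sum_range_one, pow_zero, one_smul, dysonTerm] at h
  have h2 : Tendsto (fun lam => interactionPicture L₀ t₀ (Φ lam) t) (𝓝 0) (𝓝 1) := by
    simpa using (h.trans_tendsto tendsto_id).add_const 1
  simpa [hP_one, Function.comp_def] using
    ((LinearMap.toContinuousLinearMap P).continuous.tendsto 1).comp h2

theorem hasDerivAt_map_interactionPicture
    (hΦ : ∀ lam : ℂ, IsPropagator (L₀ + lam • LI) t₀ (Φ lam)) (lam : ℂ) (t : ℝ) :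
    HasDerivAt (fun s => P (interactionPicture L₀ t₀ (Φ lam) s))
      (P (lam • (interactionGenerator L₀ LI t₀ t * interactionPicture L₀ t₀ (Φ lam) t))) t :=
  hasDerivAt_map P (hasDerivAt_interactionPicture (hΦ lam) t)

theorem hasDerivAt_map_propagator (hP_comm : CommutesWithFree P L₀)
    (hΦ : ∀ lam : ℂ, IsPropagator (L₀ + lam • LI) t₀ (Φ lam)) {lam : ℂ} {t : ℝ}
    (hunit : IsUnit (P (interactionPicture L₀ t₀ (Φ lam) t))) :
    HasDerivAt (fun s : ℝ => P (Φ lam s))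
      (masterGenerator P L₀ t₀ (Φ lam) t * P (Φ lam t)) t := by
  have hfun : (fun s : ℝ => P (Φ lam s)) =
      fun s => freeDyn L₀ (s - t₀) * P (interactionPicture L₀ t₀ (Φ lam) s) :=
    funext fun s => map_eq_freeDyn_mul hP_comm (Φ lam) s
  have hd := hasDerivAt_map_interactionPicture (P := P) hΦ lam t
  rw [hfun, map_eq_freeDyn_mul (t₀ := t₀) hP_comm (Φ lam) t]
  refine ((hasDerivAt_freeDyn_sub L₀ t₀ t).mul hd).congr_deriv ?_
  rw [masterGenerator, timeLocalGenerator, hd.deriv, add_mul]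
  simp only [mul_assoc, freeDyn_neg_mul_mul, Ring.inverse_mul_cancel _ hunit, mul_one]

theorem isBigO_masterGenerator_sub_sum_cumulant (hP_one : P 1 = 1)
    (hP_comm : CommutesWithFree P L₀)
    (hΦ : ∀ lam : ℂ, IsPropagator (L₀ + lam • LI) t₀ (Φ lam)) (t : ℝ) (N : ℕ) :
    (fun lam : ℂ => masterGenerator P L₀ t₀ (Φ lam) t -
        ∑ n ∈ Finset.range (N + 1), lam ^ n • cumulant P L₀ LI t₀ n t)
      =O[𝓝 (0 : ℂ)] fun lam : ℂ => lam ^ (N + 1) := by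
  set F := freeDyn L₀ (t - t₀) with hF
  set F' := freeDyn L₀ (-(t - t₀)) with hF'
  set V : ℂ → Superop d := fun lam => P (interactionPicture L₀ t₀ (Φ lam) t)
  have hV1 : Tendsto V (𝓝 0) (𝓝 1) := tendsto_map_interactionPicture hP_one hΦ t
  have hunit : ∀ᶠ lam in 𝓝 (0 : ℂ), IsUnit (V lam) :=
    hV1.eventually (Units.isOpen.mem_nhds isUnit_one)
  have hone : Tendsto (fun lam => F * V lam * F') (𝓝 0) (𝓝 1) := by
    simpa only [hF, hF', mul_one, freeDyn_mul_neg] using (hV1.const_mul F).mul_const F'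
  have hKV : ∀ᶠ lam in 𝓝 (0 : ℂ),
      (F * timeLocalGenerator (fun s => P (interactionPicture L₀ t₀ (Φ lam) s)) t * F') *
        (F * V lam * F') =
      F * P (lam • (interactionGenerator L₀ LI t₀ t * interactionPicture L₀ t₀ (Φ lam) t)) * F' := by
    filter_upwards [hunit] with lam hlam
    rw [timeLocalGenerator, (hasDerivAt_map_interactionPicture hΦ lam t).deriv]
    simp only [mul_assoc, hF, hF', freeDyn_neg_mul_mul]
    rw [← mul_assoc (Ring.inverse _), Ring.inverse_mul_cancel _ hlam, one_mul]
  have h := isBigO_sub_sum_of_mul_eq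
    -- The quotient `W V⁻¹` is `K - L₀`, so its order-zero coefficient is `0`; `L₀` is restored at
    -- the end.
    (c := fun n => if n = 0 then 0 else cumulant P L₀ LI t₀ n t)
    (isBigO_projected_sub_sum_moment hP_comm hΦ t (N + 1))
    (isBigO_projected_deriv_sub_sum_graveMoment hP_comm hΦ t N) hKV hone
    (sum_antidiagonal_cumulant_mul (fun n => graveMoment P L₀ LI t₀ n t)
      (fun n => moment P L₀ LI t₀ n t)
      (fun n => if n = 0 then 0 else cumulant P L₀ LI t₀ n t) rfl
      (moment_zero hP_one L₀ LI t₀ t) fun n => by cases n <;> simp [cumulant])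
  refine h.congr_left fun lam => ?_
  simp [Finset.sum_range_succ', masterGenerator, cumulant.eq_1, hF, hF']
  abel

end MasterEquation

end SuperMaster

end
theorem mainTheorem8 (d : ℕ) (L₀ LI : SuperMaster.Superop d)
    (P : SuperMaster.Superop d →ₗ[ℂ] SuperMaster.Superop d)
    (hP : SuperMaster.IsHyperprojector P)
    (hP_one : P 1 = 1)
    (hP_comm : SuperMaster.CommutesWithFree P L₀)
    (t₀ : ℝ) (Φ : ℂ → ℝ → SuperMaster.Superop d)
    (hΦ : ∀ lam : ℂ, SuperMaster.IsPropagator (L₀ + lam • LI) t₀ (Φ lam))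
    (t : ℝ) :
    (∀ᶠ lam in 𝓝 (0 : ℂ),
      IsUnit (P (Φ lam t)) ∧
      HasDerivAt (fun s : ℝ => P (Φ lam s))
        (SuperMaster.masterGenerator P L₀ t₀ (Φ lam) t * P (Φ lam t)) t) ∧
    (∀ N : ℕ,
      (fun lam : ℂ => SuperMaster.masterGenerator P L₀ t₀ (Φ lam) t -
          ∑ n ∈ Finset.range (N + 1), lam ^ n • SuperMaster.cumulant P L₀ LI t₀ n t)
        =O[𝓝 (0 : ℂ)] fun lam : ℂ => lam ^ (N + 1)) ∧
    (∀ k : ℕ, 1 ≤ k →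
      DifferentiableAt ℝ (SuperMaster.moment P L₀ LI t₀ k) t ∧
      SuperMaster.graveMoment P L₀ LI t₀ k t =
        deriv (SuperMaster.moment P L₀ LI t₀ k) t -
          ⁅L₀, SuperMaster.moment P L₀ LI t₀ k t⁆) := by
  refine ⟨?_, SuperMaster.isBigO_masterGenerator_sub_sum_cumulant hP_one hP_comm hΦ t, ?_⟩
  · filter_upwards [(SuperMaster.tendsto_map_interactionPicture hP_one hΦ t).eventually
      (Units.isOpen.mem_nhds isUnit_one)] with lam hlam
    refine ⟨?_, SuperMaster.hasDerivAt_map_propagator hP_comm hΦ hlam⟩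
    -- `P(Φ)` differs from the invertible `P(Φ_I)` only by the unit `F` on the left.
    rw [SuperMaster.map_eq_freeDyn_mul (t₀ := t₀) hP_comm]
    exact (SuperMaster.isUnit_freeDyn L₀ (t - t₀)).mul hlam
  · rintro (_ | k) hk
    · omega
    · have h := SuperMaster.hasDerivAt_moment_succ hP_comm LI t₀ k t
      exact ⟨h.differentiableAt, by rw [h.deriv, add_sub_cancel_right]⟩
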